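/- Let $n$ be the dimension, let $f:\mathbb{R}^n\to\mathbb{R}^n$, and consider $\frac{d}{dt}x(t)=f(x(t))$. Write $|\cdot|$ for the Euclidean norm, $\mathbb{S}^{n-1}$ for the unit sphere of $\mathbb{R}^n$, and $Df(x)$ for the Jacobian matrix of $f$. For $x_0\in\mathbb{R}^n$ whose trajectory $x(t)$, $x(0)=x_0$, exists for all $t\ge 0$, and for $y_0\in\mathbb{S}^{n-1}$, let $y(t)$ solve $\frac{d}{dt}y(t)=Df(x(t))\,y(t)$, $y(0)=y_0$, and put $$\mu(x_0,y_0)=\limsup_{t\to\infty}\frac1t\log|y(t)| .$$ For a set $\Omega\subset\mathbb{R}^n$ whose trajectories exist for all $t\ge0$, the maximal Lyapunov exponent is $$\mu^*_\Omega=\sup_{x_0\in\Omega,\ y_0\in\mathbb{S}^{n-1}}\mu(x_0,y_0).$$ For $\mathcal{B}\subset\mathbb{R}^n$ let $\mathcal{C}^1(\mathcal{B}\times\mathbb{S}^{n-1})$ be the set of restrictions to $\mathcal{B}\times\mathbb{S}^{n-1}$ of $\mathcal{C}^1$ functions $V(x,z)$ from $\mathbb{R}^n\times\mathbb{R}^n$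 to $\mathbb{R}$ (the gradients below are those of the $\mathcal{C}^1$ function on $\mathbb{R}^n\times\mathbb{R}^n$), and put $$U(\mathcal{B})=\inf_{V\in\mathcal{C}^1(\mathcal{B}\times\mathbb{S}^{n-1})}\ \sup_{x\in\mathcal{B},\ z\in\mathbb{S}^{n-1}}\Big(z^{\mathsf T}Df(x)z+f(x)\cdot\nabla_xV(x,z)+\big[Df(x)z-(z^{\mathsf T}Df(x)z)z\big]\cdot\nabla_zV(x,z)\Big).$$ All suprema and infima are taken in $[-\infty,+\infty]$, with $\sup\emptyset=-\infty$. 1. Let $f\in\mathcal{C}^1(\mathbb{R}^n,\mathbb{R}^n)$, and let $\mathcal{B}_0,\mathcal{B}\subset\mathbb{R}^n$ be such that each trajectory $x(t)$ with $x(0)\in\mathcal{B}_0$ exists and is bounded for $t\ge0$ (not necessarily uniformly in $x(0)$) and eventually remains in $\mathcal{B}$, that is, $x(t)\in\mathcal{B}$ for all sufficiently large $t$. Then $\mu^*_{\mathcal{B}_0}\le U(\mathcal{B})$. 2. Let $f\in\mathcal{C}^2(\mathbb{R}^n,\mathbb{R}^n)$, and let $\mathcal{B}\subset\mathbb{R}^n$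 be compact and forward invariant, meaning that no trajectory starting in $\mathcal{B}$ leaves $\mathcal{B}$ forward in time. Then $\mu^*_{\mathcal{B}}=U(\mathcal{B})$. -/

import Mathlib

open Filter Set Metric

/-- `x` solves the autonomous equation `dx/dt = f(x)` on the time interval `J`
(with one-sided derivatives at endpoints of `J` that belong to `J`). -/
def IsSolutionOn {n : ℕ} (f : EuclideanSpace ℝ (Fin n) → EuclideanSpace ℝ (Fin n))
    (x : ℝ → EuclideanSpace ℝ (Fin n)) (J : Set ℝ) : Prop :=
  ∀ t ∈ J, HasDerivWithinAt x (f (x t)) J t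

/-- `y` solves the linearized (variational) equation `dy/dt = Df(x(t)) y` along `x`
on the time interval `J`. -/
def IsLinearizedSolutionOn {n : ℕ} (f : EuclideanSpace ℝ (Fin n) → EuclideanSpace ℝ (Fin n))
    (x y : ℝ → EuclideanSpace ℝ (Fin n)) (J : Set ℝ) : Prop :=
  ∀ t ∈ J, HasDerivWithinAt y (fderiv ℝ f (x t) (y t)) J t

/-- `m = μ(x₀, y₀) = limsup_{t → ∞} (1/t) log ‖y(t)‖`, where `x` is the forward trajectory from
`x₀` and `y` is the solution of the linearized equation along `x` from `y₀`.
For continuously differentiable `f`, the solutions `x` and `y`, hence also `m`, are unique. -/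
def IsLyapunovExponent {n : ℕ} (f : EuclideanSpace ℝ (Fin n) → EuclideanSpace ℝ (Fin n))
    (x₀ y₀ : EuclideanSpace ℝ (Fin n)) (m : EReal) : Prop :=
  ∃ x y : ℝ → EuclideanSpace ℝ (Fin n),
    IsSolutionOn f x (Ici 0) ∧ x 0 = x₀ ∧
    IsLinearizedSolutionOn f x y (Ici 0) ∧ y 0 = y₀ ∧
    m = limsup (fun t : ℝ => ((1 / t * Real.log ‖y t‖ : ℝ) : EReal)) atTop

/-- The maximal Lyapunov exponent `μ*_Ω`, the supremum of `μ(x₀, y₀)` over `x₀ ∈ Ω` and unit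
vectors `y₀`. -/
noncomputable def maximalLyapunovExponent {n : ℕ}
    (f : EuclideanSpace ℝ (Fin n) → EuclideanSpace ℝ (Fin n))
    (Ω : Set (EuclideanSpace ℝ (Fin n))) : EReal :=
  sSup {m : EReal | ∃ x₀ ∈ Ω, ∃ y₀ ∈ sphere (0 : EuclideanSpace ℝ (Fin n)) 1,
    IsLyapunovExponent f x₀ y₀ m}

/-- No trajectory that starts in `B` leaves `B` forward in time. The solutions are taken on
arbitrary intervals `[0, T]`, so that global existence is not presupposed. -/
def IsForwardInvariantSet {n : ℕ} (f : EuclideanSpace ℝ (Fin n) → EuclideanSpace ℝ (Fin n))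
    (B : Set (EuclideanSpace ℝ (Fin n))) : Prop :=
  ∀ (T : ℝ) (x : ℝ → EuclideanSpace ℝ (Fin n)), IsSolutionOn f x (Icc 0 T) → x 0 ∈ B →
    ∀ t ∈ Icc 0 T, x t ∈ B

/-- `Φ(x, z) = zᵀ Df(x) z`. -/
noncomputable def stretchRate {n : ℕ}
    (f : EuclideanSpace ℝ (Fin n) → EuclideanSpace ℝ (Fin n))
    (x z : EuclideanSpace ℝ (Fin n)) : ℝ :=
  inner ℝ z (fderiv ℝ f x z)

/-- `ℓ(x, z) = Df(x) z - (zᵀ Df(x) z) z`. -/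
noncomputable def projectedField {n : ℕ}
    (f : EuclideanSpace ℝ (Fin n) → EuclideanSpace ℝ (Fin n))
    (x z : EuclideanSpace ℝ (Fin n)) : EuclideanSpace ℝ (Fin n) :=
  fderiv ℝ f x z - stretchRate f x z • z

/-- `zᵀ Df z + f · ∇ₓV + [Df z - (zᵀ Df z) z] · ∇_z V` at `(x, z)`. -/
noncomputable def auxiliaryExpr {n : ℕ}
    (f : EuclideanSpace ℝ (Fin n) → EuclideanSpace ℝ (Fin n))
    (V : EuclideanSpace ℝ (Fin n) × EuclideanSpace ℝ (Fin n) → ℝ)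
    (x z : EuclideanSpace ℝ (Fin n)) : ℝ :=
  stretchRate f x z
    + inner ℝ (f x) (gradient (fun x' => V (x', z)) x)
    + inner ℝ (projectedField f x z) (gradient (fun z' => V (x, z')) z)

/-- The infimum over `V ∈ C¹(B × S^{n-1})` of the supremum of `auxiliaryExpr f V` over
`B × S^{n-1}`. A function is in `C¹(B × S^{n-1})` when it is the restriction of a `C¹` function on
`ℝⁿ × ℝⁿ`, so the infimum runs over `C¹` functions on `ℝⁿ × ℝⁿ`. -/
noncomputable def auxiliaryBound {n : ℕ}
    (f : EuclideanSpace ℝ (Fin n) → EuclideanSpace ℝ (Fin n))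
    (B : Set (EuclideanSpace ℝ (Fin n))) : EReal :=
  ⨅ (V : EuclideanSpace ℝ (Fin n) × EuclideanSpace ℝ (Fin n) → ℝ) (_ : ContDiff ℝ 1 V),
    ⨆ (x ∈ B) (z ∈ sphere (0 : EuclideanSpace ℝ (Fin n)) 1), ((auxiliaryExpr f V x z : ℝ) : EReal)

/-! Write `z = y / |y|`. Then `(log |y|)' = Φ(x, z)`, and the pair `w = (x, z)` follows the
autonomous field `G = (f, ℓ)`, which preserves `|z| = 1`. Lyapunov exponents are thus upper limits
of time averages of `Φ` along this flow, and the auxiliary expression is `Φ + G · ∇V`.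

Upper bound: if that expression is at most `M`, then `log |y| + V(x, z) - M t` is eventually
nonincreasing. Since `V` is bounded along a bounded trajectory, the exponent is at most `M`
(`limsup_log_norm_le_auxiliaryBound`).

Reverse bound: the weighted integral `∫₀ᵀ (1 - t/T) Φ(γ w t) dt` is chosen as `V`. It turns `Φ + G ·
∇V` into the average of `Φ` over `[0, T]`. This `V` is handled as a Lipschitz function only, and
mollification makes it `C¹` at a uniformly small cost (`exists_contDiff_fderiv_approx`). Hence for
every `a < U(B)` and every `T`, some starting point has average at least `a` over `[0, T]`.
Restarting at a minimum of the running integral minus `a' t`, with `a' < a`, keeps all averages up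
to a long horizon at least `a'`. Compactness then gives one point good for all times
(`IsGlobalFlow.exists_forall_mul_le_integral`), whose linearized solution has exponent at least
`a'`. A cutoff away from `B × S^{n-1}` makes `G` globally Lipschitz. -/

/-- `γ w` is the global integral curve of the vector field `G` that starts at `w`. -/
structure IsGlobalFlow {W : Type*} [NormedAddCommGroup W] [NormedSpace ℝ W]
    (G : W → W) (γ : W → ℝ → W) : Prop where
  map_zero : ∀ w, γ w 0 = w
  hasDerivAt : ∀ w t, HasDerivAt (γ w) (G (γ w t)) t

/-! ### Global flows and approximation of time averages -/

section Flow

variable {W : Type*} [NormedAddCommGroup W] [NormedSpace ℝ W]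

/-- Since `G` is bounded by `C`, a solution on `[-N, N]` cannot leave the ball of radius `C * N`, so
Picard–Lindelöf applies on every such interval. Uniqueness glues the pieces. -/
theorem exists_isGlobalFlow [CompleteSpace W] {G : W → W} {K C : NNReal}
    (hG : LipschitzWith K G) (hC : ∀ w, ‖G w‖ ≤ C) : ∃ γ, IsGlobalFlow G γ := by
  have local_sol : ∀ (w : W) (N : ℝ), ∃ α : ℝ → W, 0 < N →
      α 0 = w ∧ ∀ t ∈ Ioo (-N) N, HasDerivAt α (G (α t)) t := by
    intro w N
    by_cases hN : 0 < N
    · have h0 : (0 : ℝ) ∈ Icc (-N) N := ⟨by linarith, hN.le⟩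
      have hpl : IsPicardLindelof (fun _ => G) (⟨0, h0⟩ : Icc (-N) N) w
          (C * N.toNNReal) 0 C K :=
        ⟨fun _ _ => hG.lipschitzOnWith, fun _ _ => continuousOn_const, fun _ _ x _ => hC x, by
          simp [hN.le]⟩
      obtain ⟨α, h1, h2⟩ := hpl.exists_eq_forall_mem_Icc_hasDerivWithinAt₀
      exact ⟨α, fun _ => ⟨h1, fun t ht =>
        (h2 t (Ioo_subset_Icc_self ht)).hasDerivAt (Icc_mem_nhds ht.1 ht.2)⟩⟩
    · exact ⟨fun _ => w, fun h => absurd h hN⟩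
  choose α hα using local_sol
  have agree : ∀ w (N M : ℝ), 0 < N → N ≤ M → EqOn (α w N) (α w M) (Ioo (-N) N) := by
    intro w N M hN hNM
    refine ODE_solution_unique_of_mem_Ioo (v := fun _ => G) (s := fun _ => univ) (K := K) (t₀ := 0)
      (fun t _ => hG.lipschitzOnWith) ⟨by linarith, hN⟩
      (fun t ht => ⟨(hα w N hN).2 t ht, trivial⟩)
      (fun t ht => ⟨(hα w M (hN.trans_le hNM)).2 t ⟨by linarith [ht.1], by linarith [ht.2]⟩, trivial⟩)
      ?_
    rw [(hα w N hN).1, (hα w M (hN.trans_le hNM)).1]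
  -- The `+ 1` places `t` inside the open interval where the chosen piece is a solution.
  refine ⟨fun w t => α w (|t| + 1) t, fun w => (hα w _ (by positivity)).1, fun w t => ?_⟩
  have hpos : ∀ s : ℝ, 0 < |s| + 1 := fun s => by positivity
  have hmem : ∀ s : ℝ, s ∈ Ioo (-(|s| + 1)) (|s| + 1) := fun s =>
    abs_lt.mp (lt_add_one _)
  have heq : ∀ s ∈ Ioo (-(|t| + 1)) (|t| + 1), α w (|s| + 1) s = α w (|t| + 1) s := by
    intro s hs
    rcases le_total (|s| + 1) (|t| + 1) with h | h
    · exact agree w _ _ (hpos s) h (hmem s)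
    · exact (agree w _ _ (hpos t) h hs).symm
  refine ((hα w _ (hpos t)).2 t (hmem t)).congr_of_eventuallyEq ?_
  filter_upwards [Ioo_mem_nhds (hmem t).1 (hmem t).2] with s hs using heq s hs

namespace IsGlobalFlow

variable {G : W → W} {γ : W → ℝ → W} {K : NNReal}

theorem continuous (h : IsGlobalFlow G γ) (w : W) : Continuous (γ w) :=
  continuous_iff_continuousAt.2 fun t => (h.hasDerivAt w t).continuousAt

theorem map_add (h : IsGlobalFlow G γ) (hG : LipschitzWith K G) (w : W) (s t : ℝ) :
    γ w (s + t) = γ (γ w s) t := by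
  have := ODE_solution_unique_univ (v := fun _ => G) (s := fun _ => univ) (K := K) (t₀ := 0)
    (f := fun t => γ w (s + t)) (g := γ (γ w s)) (fun t => hG.lipschitzOnWith)
    (fun t => ⟨(h.hasDerivAt w (s + t)).comp_const_add s t, trivial⟩)
    (fun t => ⟨h.hasDerivAt _ t, trivial⟩) (by simp [h.map_zero])
  exact congrFun this t

theorem dist_le (h : IsGlobalFlow G γ) (hG : LipschitzWith K G) (w w' : W) {t : ℝ} (ht : 0 ≤ t) :
    dist (γ w t) (γ w' t) ≤ dist w w' * Real.exp (K * t) := by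
  have := dist_le_of_trajectories_ODE (v := fun _ => G) (K := K) (f := γ w) (g := γ w') (a := 0)
    (b := t) (δ := dist w w') (fun _ => hG) (h.continuous w).continuousOn
    (fun s _ => (h.hasDerivAt w s).hasDerivWithinAt) (h.continuous w').continuousOn
    (fun s _ => (h.hasDerivAt w' s).hasDerivWithinAt) (by simp [h.map_zero]) t ⟨ht, le_rfl⟩
  simpa using this

/-- A weighted integral of a Lipschitz observable along trajectories is a Lipschitz function of
the initial condition. -/
theorem exists_lipschitzWith_integral (h : IsGlobalFlow G γ) (hG : LipschitzWith K G) {φ : W → ℝ}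
    {L : NNReal} (hφ : LipschitzWith L φ) {a : ℝ → ℝ} (ha : Continuous a) {T : ℝ} (hT : 0 ≤ T) :
    ∃ M : NNReal, LipschitzWith M (fun w => ∫ t in (0 : ℝ)..T, a t * φ (γ w t)) := by
  obtain ⟨A, hA⟩ := isCompact_Icc.exists_bound_of_continuousOn (s := Icc 0 T) ha.continuousOn
  have hA0 : 0 ≤ A := (norm_nonneg _).trans (hA 0 ⟨le_rfl, hT⟩)
  refine ⟨Real.toNNReal (A * (L * Real.exp (K * T)) * T), LipschitzWith.of_dist_le_mul
    fun w w' => ?_⟩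
  have hint : ∀ w, IntervalIntegrable (fun t => a t * φ (γ w t)) MeasureTheory.volume 0 T :=
    fun w => (ha.mul (hφ.continuous.comp (h.continuous w))).intervalIntegrable _ _
  rw [Real.coe_toNNReal _ (by positivity), Real.dist_eq, ← intervalIntegral.integral_sub (hint w)
    (hint w'), ← Real.norm_eq_abs]
  refine (intervalIntegral.norm_integral_le_of_norm_le_const
    (C := A * (L * Real.exp (K * T)) * dist w w') fun t ht => ?_).trans (le_of_eq ?_)
  · rw [uIoc_of_le hT] at ht
    rw [← mul_sub, norm_mul, mul_assoc]
    refine mul_le_mul (hA t ⟨ht.1.le, ht.2⟩) ?_ (norm_nonneg _) hA0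
    rw [← dist_eq_norm]
    refine (hφ.dist_le_mul _ _).trans ?_
    rw [mul_assoc]
    refine mul_le_mul_of_nonneg_left ?_ L.2
    rw [mul_comm]
    refine (h.dist_le hG w w' ht.1.le).trans ?_
    gcongr
    exact ht.2
  · rw [sub_zero, abs_of_nonneg hT]; ring

end IsGlobalFlow

/-- Substituting `u = s + t` moves `s` out of `h`, which need only be continuous, into the weight
and the limits. The slope of the weight gives the average; the weight vanishes at `T` and is `1` at
`0`, so the endpoints contribute only `-h 0`. -/
theorem hasDerivAt_weighted_integral_shift {h : ℝ → ℝ} (hh : Continuous h) {T : ℝ} (hT : 0 < T) :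
    HasDerivAt (fun s => ∫ t in (0 : ℝ)..T, (1 - t / T) * h (s + t))
      ((∫ t in (0 : ℝ)..T, h t) / T - h 0) 0 := by
  have hP : Continuous fun t => t * h t := continuous_id.mul hh
  have hi : ∀ a b, IntervalIntegrable h MeasureTheory.volume a b :=
    fun a b => hh.intervalIntegrable _ _
  have hPi : ∀ a b, IntervalIntegrable (fun t => t * h t) MeasureTheory.volume a b :=
    fun a b => hP.intervalIntegrable _ _
  have key : (fun s => ∫ t in (0 : ℝ)..T, (1 - t / T) * h (s + t)) = fun s =>
      (1 + s / T) * ((∫ t in (0 : ℝ)..(T + s), h t) - ∫ t in (0 : ℝ)..s, h t)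
        - ((∫ t in (0 : ℝ)..(T + s), t * h t) - ∫ t in (0 : ℝ)..s, t * h t) / T := by
    funext s
    have h1 := intervalIntegral.integral_comp_add_left (a := 0) (b := T)
      (fun u => (1 - (u - s) / T) * h u) s
    simp only [add_sub_cancel_left, add_zero] at h1
    rw [h1, intervalIntegral.integral_interval_sub_left (hi _ _) (hi _ _),
      intervalIntegral.integral_interval_sub_left (hPi _ _) (hPi _ _),
      ← intervalIntegral.integral_const_mul, ← intervalIntegral.integral_div,
      ← intervalIntegral.integral_sub ((hi _ _).const_mul _) ((hPi _ _).div_const _), add_comm s T]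
    refine intervalIntegral.integral_congr fun u _ => ?_
    ring
  rw [key]
  have hd : ∀ {g : ℝ → ℝ}, Continuous g → ∀ x, HasDerivAt (fun s => ∫ t in (0 : ℝ)..s, g t) (g x) x :=
    fun hg x => intervalIntegral.integral_hasDerivAt_right (hg.intervalIntegrable _ _)
      (hg.stronglyMeasurableAtFilter _ _) hg.continuousAt
  have hd' : ∀ {g : ℝ → ℝ}, Continuous g →
      HasDerivAt (fun s => ∫ t in (0 : ℝ)..(T + s), g t) (g (T + 0)) 0 :=
    fun hg => (hd hg (T + 0)).comp_const_add T 0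
  have := ((((hasDerivAt_id (0 : ℝ)).div_const T).const_add 1).mul ((hd' hh).sub (hd hh 0))).sub
    (((hd' hP).sub (hd hP 0)).div_const T)
  convert! this using 1
  simp
  field_simp
  ring

/-- Mollification: a Lipschitz function `V` whose derivative along the Lipschitz field `G` is the
Lipschitz function `g` is approximated by `C¹` functions whose derivatives along `G` are uniformly
close to `g`. -/
theorem exists_contDiff_fderiv_approx [FiniteDimensional ℝ W] {G : W → W} {V g : W → ℝ}
    {K L M : NNReal} (hG : LipschitzWith K G) (hV : LipschitzWith L V) (hg : LipschitzWith M g)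
    (hd : ∀ w, HasDerivAt (fun s : ℝ => V (w + s • G w)) (g w) 0) {ε : ℝ} (hε : 0 < ε) :
    ∃ V' : W → ℝ, ContDiff ℝ 1 V' ∧ ∀ w, |fderiv ℝ V' w (G w) - g w| ≤ ε := by
  borelize W
  let μ : MeasureTheory.Measure W := MeasureTheory.Measure.addHaar
  -- The mollification error is at most `(L * K + M) * r`; the `+ 1` keeps the denominator positive.
  set r : ℝ := ε / (L * K + M + 1) with hr
  have hden : (0 : ℝ) < L * K + M + 1 := by positivity
  have hr0 : 0 < r := by positivity
  let b : ContDiffBump (0 : W) := ⟨r / 2, r, by positivity, by linarith⟩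
  set η : W → ℝ := b.normed μ with hη
  have hη0 : ∀ y, 0 ≤ η y := fun y => b.nonneg_normed y
  have hηc : Continuous η := b.continuous_normed
  have hηs : HasCompactSupport η := b.hasCompactSupport_normed
  have hηi : MeasureTheory.Integrable η μ := b.integrable_normed
  have hη1 : ∫ y, η y ∂μ = 1 := b.integral_normed
  have hηz : ∀ y, r ≤ ‖y‖ → η y = 0 := by
    intro y hy
    by_contra hne
    have : y ∈ Function.support (b.normed μ) := hne
    rw [b.support_normed_eq, mem_ball_zero_iff] at this
    exact absurd this (not_lt.2 hy)
  have hint : ∀ {F : W → ℝ}, Continuous F → MeasureTheory.Integrable (fun y => η y * F y) μ :=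
    fun hF => (hηc.mul hF).integrable_of_hasCompactSupport hηs.mul_right
  have hbound : ∀ {F : W → ℝ} {c : ℝ}, Continuous F → (∀ y, ‖y‖ < r → |F y| ≤ c) →
      |∫ y, η y * F y ∂μ| ≤ c := by
    intro F c hF hc
    have : ‖∫ y, η y * F y ∂μ‖ ≤ ∫ y, η y * c ∂μ := by
      refine MeasureTheory.norm_integral_le_of_norm_le (hηi.mul_const c) (MeasureTheory.ae_of_all _ fun y => ?_)
      rw [norm_mul, Real.norm_of_nonneg (hη0 y)]
      rcases lt_or_ge ‖y‖ r with h | h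
      · exact mul_le_mul_of_nonneg_left (hc y h) (hη0 y)
      · simp [hηz y h]
    rwa [MeasureTheory.integral_mul_const, hη1, one_mul] at this
  set V' : W → ℝ := fun w => ∫ y, η y * V (w - y) ∂μ with hV'
  have hVsmooth : ContDiff ℝ 1 V' :=
    hηs.contDiff_convolution_left (ContinuousLinearMap.lsmul ℝ ℝ) (n := 1) b.contDiff_normed
      hV.continuous.locallyIntegrable
  refine ⟨V', hVsmooth, fun w => ?_⟩
  have hGc := hG.continuous
  have hVc := hV.continuous
  have hgc := hg.continuous
  have hlimA : Tendsto (fun s : ℝ => ∫ y, η y * (s⁻¹ * (V (w - y + s • G (w - y)) - V (w - y))) ∂μ)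
      (nhdsWithin 0 {0}ᶜ) (nhds (∫ y, η y * g (w - y) ∂μ)) := by
    refine MeasureTheory.tendsto_integral_filter_of_dominated_convergence
      (fun y => η y * (L * ‖G (w - y)‖)) ?_ ?_ (hint (by fun_prop)) (MeasureTheory.ae_of_all _ fun y => ?_)
    · exact Eventually.of_forall fun s => (by fun_prop : Continuous _).aestronglyMeasurable
    · filter_upwards [self_mem_nhdsWithin] with s hs
      refine MeasureTheory.ae_of_all _ fun y => ?_
      rw [norm_mul, Real.norm_of_nonneg (hη0 y)]
      refine mul_le_mul_of_nonneg_left ?_ (hη0 y)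
      have := hV.dist_le_mul (w - y + s • G (w - y)) (w - y)
      rw [dist_eq_norm, dist_eq_norm, add_sub_cancel_left, norm_smul] at this
      rw [norm_mul, norm_inv, inv_mul_le_iff₀ (norm_pos_iff.2 hs)]
      linarith
    · have := hasDerivAt_iff_tendsto_slope_zero.1 (hd (w - y))
      simp only [zero_add, zero_smul, add_zero, smul_eq_mul] at this
      exact this.const_mul _
  have hlimB : Tendsto (fun s : ℝ => s⁻¹ * (V' (w + s • G w) - V' w))
      (nhdsWithin 0 {0}ᶜ) (nhds (fderiv ℝ V' w (G w))) := by
    have h1 : HasDerivAt (fun s : ℝ => V' (w + s • G w)) (fderiv ℝ V' w (G w)) 0 := by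
      have h2 : HasDerivAt (fun s : ℝ => w + s • G w) (G w) 0 := by
        simpa using ((hasDerivAt_id (0 : ℝ)).smul_const (G w)).const_add w
      have h3 : HasFDerivAt V' (fderiv ℝ V' w) (w + (0 : ℝ) • G w) := by
        simpa using (hVsmooth.differentiable (by norm_num) w).hasFDerivAt
      exact h3.comp_hasDerivAt 0 h2
    simpa using hasDerivAt_iff_tendsto_slope_zero.1 h1
  -- A commutator estimate on difference quotients: for `‖y‖ < r` the displacements `s • G w` and `s
  -- • G (w - y)` differ by at most `|s| K r`, which `V` turns into `L K r` after division by `s`.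
  have hAB : |fderiv ℝ V' w (G w) - ∫ y, η y * g (w - y) ∂μ| ≤ L * K * r := by
    refine le_of_tendsto (hlimB.sub hlimA).abs ?_
    filter_upwards [self_mem_nhdsWithin] with s hs
    have : s⁻¹ * (V' (w + s • G w) - V' w)
        - ∫ y, η y * (s⁻¹ * (V (w - y + s • G (w - y)) - V (w - y))) ∂μ
        = ∫ y, η y * (s⁻¹ * (V (w + s • G w - y) - V (w - y + s • G (w - y)))) ∂μ := by
      have i1 := hint (F := fun y => V (w + s • G w - y)) (by fun_prop)
      have i2 := hint (F := fun y => V (w - y)) (by fun_prop)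
      have i3 := hint (F := fun y => s⁻¹ * (V (w - y + s • G (w - y)) - V (w - y))) (by fun_prop)
      have i4 : MeasureTheory.Integrable
          (fun y => s⁻¹ * (η y * V (w + s • G w - y) - η y * V (w - y))) μ :=
        (i1.sub i2).const_mul _
      rw [hV', ← MeasureTheory.integral_sub i1 i2, ← MeasureTheory.integral_const_mul,
        ← MeasureTheory.integral_sub i4 i3]
      refine MeasureTheory.integral_congr_ae (MeasureTheory.ae_of_all _ fun y => ?_)
      simp only
      ring
    rw [this]
    refine hbound (by fun_prop) fun y hy => ?_
    have h1 := hV.dist_le_mul (w + s • G w - y) (w - y + s • G (w - y))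
    have h2 := hG.dist_le_mul w (w - y)
    rw [dist_eq_norm, dist_eq_norm, show w + s • G w - y - (w - y + s • G (w - y))
      = s • (G w - G (w - y)) by rw [smul_sub]; abel, norm_smul, ← dist_eq_norm (G w)] at h1
    rw [dist_eq_norm w, sub_sub_cancel] at h2
    rw [← Real.norm_eq_abs, norm_mul, norm_inv, inv_mul_le_iff₀ (norm_pos_iff.2 hs)]
    calc _ ≤ L * (‖s‖ * dist (G w) (G (w - y))) := h1
      _ ≤ L * (‖s‖ * (K * r)) := by gcongr; exact h2.trans (by gcongr)
      _ = _ := by ring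
  have hAg : |(∫ y, η y * g (w - y) ∂μ) - g w| ≤ M * r := by
    have : (∫ y, η y * g (w - y) ∂μ) - g w = ∫ y, η y * (g (w - y) - g w) ∂μ := by
      simp only [mul_sub]
      rw [MeasureTheory.integral_sub (hint (by fun_prop)) (hηi.mul_const _),
        MeasureTheory.integral_mul_const, hη1, one_mul]
    rw [this]
    refine hbound (by fun_prop) fun y hy => ?_
    have h1 := hg.dist_le_mul (w - y) w
    rw [dist_eq_norm (w - y), sub_sub_cancel_left, norm_neg] at h1
    exact h1.trans (by gcongr)
  calc |fderiv ℝ V' w (G w) - g w| ≤ L * K * r + M * r :=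
        (abs_sub_le _ (∫ y, η y * g (w - y) ∂μ) _).trans (add_le_add hAB hAg)
    _ ≤ (L * K + M + 1) * r := by nlinarith
    _ = ε := by rw [hr]; field_simp

/-- For a Lipschitz observable `φ`, the function `φ + G · ∇V` can be made uniformly close to the
time average of `φ` over `[0, T]` by the choice of a `C¹` function `V`. -/
theorem IsGlobalFlow.exists_contDiff_approx_average [FiniteDimensional ℝ W] {G : W → W}
    {γ : W → ℝ → W} {K L : NNReal} (h : IsGlobalFlow G γ) (hG : LipschitzWith K G)
    {φ : W → ℝ} (hφ : LipschitzWith L φ) {T : ℝ} (hT : 0 < T) {ε : ℝ} (hε : 0 < ε) :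
    ∃ V : W → ℝ, ContDiff ℝ 1 V ∧
      ∀ w, |φ w + fderiv ℝ V w (G w) - (∫ t in (0 : ℝ)..T, φ (γ w t)) / T| ≤ ε := by
  obtain ⟨LV, hLV⟩ := h.exists_lipschitzWith_integral hG hφ (a := fun t => 1 - t / T)
    (by fun_prop) hT.le
  obtain ⟨LA, hLA⟩ := h.exists_lipschitzWith_integral hG hφ (a := fun _ => 1 / T)
    (by fun_prop) hT.le
  have key : ∀ w, HasDerivAt
      (fun s : ℝ => ∫ t in (0 : ℝ)..T, (1 - t / T) * φ (γ (w + s • G w) t))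
      ((∫ t in (0 : ℝ)..T, 1 / T * φ (γ w t)) - φ w) 0 := by
    intro w
    set U : W → ℝ := fun w => ∫ t in (0 : ℝ)..T, (1 - t / T) * φ (γ w t) with hU
    have h1 : HasDerivAt (fun s => U (γ w s)) ((∫ t in (0 : ℝ)..T, φ (γ w t)) / T - φ w) 0 := by
      have := hasDerivAt_weighted_integral_shift (hφ.continuous.comp (h.continuous w)) hT
      simp only [Function.comp_apply, h.map_add hG] at this
      simpa only [h.map_zero] using this
    -- The straight line and the trajectory are tangent at `s = 0`, and `U` is Lipschitz, so `U` has
    -- the same derivative along both.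
    have h2 : HasDerivAt (fun s : ℝ => U (w + s • G w) - U (γ w s)) 0 0 := by
      have h3 : HasDerivAt (fun s : ℝ => (w + s • G w) - γ w s) 0 0 := by
        have h4 : HasDerivAt (fun s : ℝ => w + s • G w) (G w) 0 := by
          simpa using ((hasDerivAt_id (0 : ℝ)).smul_const (G w)).const_add w
        have h5 := h4.fun_sub (h.hasDerivAt w 0)
        rwa [h.map_zero, sub_self] at h5
      rw [hasDerivAt_iff_isLittleO] at h3 ⊢
      simp only [h.map_zero, zero_smul, add_zero, sub_self, smul_zero, sub_zero] at h3 ⊢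
      refine Asymptotics.IsBigO.trans_isLittleO ?_ h3
      refine Asymptotics.IsBigO.of_bound LV (Eventually.of_forall fun s => ?_)
      simpa [dist_eq_norm] using hLV.dist_le_mul (w + s • G w) (γ w s)
    have h5 := h2.add h1
    rw [intervalIntegral.integral_const_mul]
    convert! h5 using 1
    · funext s; simp [hU]
    · ring
  obtain ⟨V, hV, hV'⟩ := exists_contDiff_fderiv_approx hG hLV (hLA.sub hφ) key hε
  refine ⟨V, hV, fun w => le_of_eq_of_le ?_ (hV' w)⟩
  rw [intervalIntegral.integral_const_mul]
  congr 1
  ring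

end Flow

/-! ### From finite horizons to a single initial condition -/

/-- If on a compact forward invariant set every time horizon `T` admits an initial condition whose
time average over `[0, T]` is at least `a`, then for `a' < a` there is a single initial condition
all of whose finite time averages are at least `a'`. -/
theorem IsGlobalFlow.exists_forall_mul_le_integral {W : Type*} [NormedAddCommGroup W]
    [NormedSpace ℝ W] {G : W → W} {γ : W → ℝ → W} {K L : NNReal} (h : IsGlobalFlow G γ)
    (hG : LipschitzWith K G) {φ : W → ℝ} (hφ : LipschitzWith L φ) {S : Set W} (hS : IsCompact S)
    (hinv : ∀ w ∈ S, ∀ t, 0 ≤ t → γ w t ∈ S) {a a' : ℝ} (haa : a' < a)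
    (hlarge : ∀ T, 0 < T → ∃ w ∈ S, a * T ≤ ∫ t in (0 : ℝ)..T, φ (γ w t)) :
    ∃ p ∈ S, ∀ τ, 0 ≤ τ → a' * τ ≤ ∫ t in (0 : ℝ)..τ, φ (γ p t) := by
  obtain ⟨C, hC⟩ := hS.exists_bound_of_continuousOn hφ.continuous.continuousOn
  have hcont : ∀ w, Continuous fun t => φ (γ w t) := fun w => hφ.continuous.comp (h.continuous w)
  have hint : ∀ w s t, IntervalIntegrable (fun t => φ (γ w t)) MeasureTheory.volume s t :=
    fun w s t => (hcont w).intervalIntegrable _ _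
  have step : ∀ N : ℕ, ∃ p ∈ S, ∀ τ ∈ Icc (0 : ℝ) N, a' * τ ≤ ∫ t in (0 : ℝ)..τ, φ (γ p t) := by
    intro N
    set D : ℝ := |C| + |a'| + 1 with hD
    have hDpos : 0 < D := by positivity
    have hδ : 0 < a - a' := sub_pos.2 haa
    -- Beyond its minimum `q` must climb to at least `D * (N + 1)` at slope at most `D`, so this `T`
    -- leaves time at least `N` after the minimizer.
    set T : ℝ := D * (N + 1) / (a - a') with hT
    have hTpos : 0 < T := by positivity
    obtain ⟨w, hw, hwT⟩ := hlarge T hTpos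
    set q : ℝ → ℝ := fun s => (∫ t in (0 : ℝ)..s, φ (γ w t)) - a' * s with hq
    have hqc : Continuous q :=
      (intervalIntegral.continuous_primitive (fun s t => hint w s t) 0).sub (by fun_prop)
    obtain ⟨s, hs, hmin⟩ := isCompact_Icc.exists_isMinOn (s := Icc 0 T) ⟨0, le_rfl, hTpos.le⟩
      hqc.continuousOn
    have hqs : q s ≤ 0 := by
      have := hmin (show (0 : ℝ) ∈ Icc 0 T from ⟨le_rfl, hTpos.le⟩)
      simpa [hq] using this
    have hqT : D * (N + 1) ≤ q T := by
      have : (a - a') * T = D * (N + 1) := by rw [hT]; field_simp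
      simp only [hq]
      linarith
    have hdiff : ∀ u, q u - q s = (∫ t in s..u, φ (γ w t)) - a' * (u - s) := by
      intro u
      simp only [hq]
      rw [← intervalIntegral.integral_interval_sub_left (hint w 0 u) (hint w 0 s)]
      ring
    have hbd : (∫ t in s..T, φ (γ w t)) ≤ |C| * (T - s) := by
      have := intervalIntegral.norm_integral_le_of_norm_le_const (a := s) (b := T) (C := |C|)
        (f := fun t => φ (γ w t)) fun t ht => by
          rw [uIoc_of_le hs.2] at ht
          exact (hC _ (hinv w hw t (hs.1.trans ht.1.le))).trans (le_abs_self C)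
      rw [abs_of_nonneg (sub_nonneg.2 hs.2)] at this
      exact (le_abs_self _).trans this
    have hlen : (N : ℝ) ≤ T - s := by
      have h1 := hdiff T
      have h2 : -a' * (T - s) ≤ |a'| * (T - s) :=
        mul_le_mul_of_nonneg_right (neg_le_abs a') (sub_nonneg.2 hs.2)
      have h3 : D * (N + 1) ≤ D * (T - s) := by
        have := sub_nonneg.2 hs.2
        rw [hD] at hqT ⊢
        nlinarith
      linarith [le_of_mul_le_mul_left h3 hDpos]
    refine ⟨γ w s, hinv w hw s hs.1, fun τ hτ => ?_⟩
    have h1 : q s ≤ q (s + τ) :=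
      hmin (show s + τ ∈ Icc 0 T from ⟨by linarith [hs.1, hτ.1], by linarith [hτ.2]⟩)
    have h2 := hdiff (s + τ)
    have h3 := intervalIntegral.integral_comp_add_left (a := 0) (b := τ) (fun t => φ (γ w t)) s
    simp only [h.map_add hG, add_zero] at h3
    rw [h3]
    rw [add_sub_cancel_left] at h2
    linarith
  -- Nested nonempty compact sets; a common point serves every horizon.
  let A : ℕ → Set W := fun N => S ∩ ⋂ τ ∈ Icc (0 : ℝ) N,
    {p | a' * τ ≤ ∫ t in (0 : ℝ)..τ, φ (γ p t)}
  have hA : ∀ N p, p ∈ A N ↔ p ∈ S ∧ ∀ τ ∈ Icc (0 : ℝ) N, a' * τ ≤ ∫ t in (0 : ℝ)..τ, φ (γ p t) :=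
    fun N p => by simp [A]
  have hclosed : ∀ N, IsClosed (A N) := by
    refine fun N => hS.isClosed.inter (isClosed_biInter fun τ hτ => ?_)
    obtain ⟨M, hM⟩ := h.exists_lipschitzWith_integral hG hφ (a := fun _ => 1) (by fun_prop) hτ.1
    simp only [one_mul] at hM
    exact isClosed_le continuous_const hM.continuous
  obtain ⟨p, hp⟩ := IsCompact.nonempty_iInter_of_sequence_nonempty_isCompact_isClosed A
    (fun N p hp => by
      rw [hA] at hp ⊢
      exact ⟨hp.1, fun τ hτ => hp.2 τ ⟨hτ.1, hτ.2.trans (by simp)⟩⟩)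
    (fun N => by
      obtain ⟨p, hp⟩ := step N
      exact ⟨p, (hA N p).2 hp⟩)
    (hS.of_isClosed_subset (hclosed 0) inter_subset_left) hclosed
  rw [mem_iInter] at hp
  refine ⟨p, ((hA 0 p).1 (hp 0)).1, fun τ hτ => ?_⟩
  obtain ⟨N, hN⟩ := exists_nat_ge τ
  exact ((hA N p).1 (hp N)).2 τ ⟨hτ, hN⟩

/-! ### Linearized dynamics on the sphere and the upper bound -/

section Trajectories

variable {n : ℕ} {f : EuclideanSpace ℝ (Fin n) → EuclideanSpace ℝ (Fin n)}
  {x x' y : ℝ → EuclideanSpace ℝ (Fin n)}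

theorem IsSolutionOn.mono {J J' : Set ℝ} (hx : IsSolutionOn f x J) (h : J' ⊆ J) :
    IsSolutionOn f x J' := fun t ht => (hx t (h ht)).mono h

theorem IsSolutionOn.continuousOn {J : Set ℝ} (hx : IsSolutionOn f x J) : ContinuousOn x J :=
  fun t ht => (hx t ht).continuousWithinAt

theorem IsSolutionOn.eqOn (hf : ContDiff ℝ 1 f) (hx : IsSolutionOn f x (Ici 0))
    (hx' : IsSolutionOn f x' (Ici 0)) (h0 : x 0 = x' 0) : EqOn x x' (Ici 0) := by
  intro T hT
  have hsub : Icc 0 T ⊆ Ici 0 := Icc_subset_Ici_self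
  obtain ⟨K, hK⟩ := LocallyLipschitzOn.exists_lipschitzOnWith_of_compact
    ((isCompact_Icc.image_of_continuousOn (hx.continuousOn.mono hsub)).union
      (isCompact_Icc.image_of_continuousOn (hx'.continuousOn.mono hsub)))
    hf.locallyLipschitz.locallyLipschitzOn
  refine ODE_solution_unique_of_mem_Icc_right (v := fun _ => f) (fun _ _ => hK)
    (hx.continuousOn.mono hsub) (fun t ht => (hx t ht.1).mono (Ici_subset_Ici.2 ht.1))
    (fun t ht => Or.inl (mem_image_of_mem _ (Ico_subset_Icc_self ht)))
    (hx'.continuousOn.mono hsub) (fun t ht => (hx' t ht.1).mono (Ici_subset_Ici.2 ht.1))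
    (fun t ht => Or.inr (mem_image_of_mem _ (Ico_subset_Icc_self ht))) h0 ⟨hT, le_rfl⟩

/-- A zero at time `T` would force `y` to vanish back to time `0`, by backward uniqueness for the
linear equation. -/
theorem IsLinearizedSolutionOn.ne_zero (hf : ContDiff ℝ 1 f) (hx : IsSolutionOn f x (Ici 0))
    (hy : IsLinearizedSolutionOn f x y (Ici 0)) (h0 : y 0 ≠ 0) {T : ℝ} (hT : 0 ≤ T) :
    y T ≠ 0 := by
  intro hyT
  have hsub : Icc 0 T ⊆ Ici 0 := Icc_subset_Ici_self
  obtain ⟨C, hC⟩ := isCompact_Icc.exists_bound_of_continuousOn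
    ((hf.continuous_fderiv one_ne_zero).comp_continuousOn (hx.continuousOn.mono hsub))
  have hyc : ContinuousOn y (Ici 0) := fun t ht => (hy t ht).continuousWithinAt
  have hd : ∀ t ∈ Ioc 0 T, HasDerivWithinAt y (fderiv ℝ f (x t) (y t)) (Iic t) t := fun t ht =>
    ((hy t ht.1.le).hasDerivAt (Ici_mem_nhds ht.1)).hasDerivWithinAt
  have := ODE_solution_unique_of_mem_Icc_left (v := fun t => fderiv ℝ f (x t))
    (s := fun _ => univ) (K := C.toNNReal) (f := y) (g := fun _ => 0) (a := 0) (b := T)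
    (fun t ht => ((fderiv ℝ f (x t)).lipschitz.weaken (by
      rw [← NNReal.coe_le_coe]
      exact (hC t (Ioc_subset_Icc_self ht)).trans (Real.le_coe_toNNReal C))).lipschitzOnWith)
    (hyc.mono hsub) hd (fun _ _ => trivial) continuousOn_const
    (fun t _ => by simpa using hasDerivWithinAt_const t (Iic t) (0 : EuclideanSpace ℝ (Fin n)))
    (fun _ _ => trivial) hyT
  exact h0 (this ⟨le_rfl, hT⟩)

theorem hasDerivWithinAt_log_norm {J : Set ℝ} (hy : IsLinearizedSolutionOn f x y J) {t : ℝ}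
    (ht : t ∈ J) (h0 : y t ≠ 0) :
    HasDerivWithinAt (fun s => Real.log ‖y s‖) (stretchRate f (x t) (‖y t‖⁻¹ • y t)) J t := by
  have h1 := ((hy t ht).norm_sq.log (by simpa using h0)).const_mul (1 / 2)
  have hn : ‖y t‖ ≠ 0 := norm_ne_zero_iff.2 h0
  convert! h1 using 1
  · funext s
    rw [Real.log_pow]
    push_cast
    ring
  · simp only [stretchRate, map_smul, inner_smul_left, inner_smul_right]
    simp only [conj_trivial]
    field_simp

theorem hasDerivWithinAt_normalized {J : Set ℝ} (hy : IsLinearizedSolutionOn f x y J) {t : ℝ}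
    (ht : t ∈ J) (h0 : ∀ s ∈ J, y s ≠ 0) :
    HasDerivWithinAt (fun s => ‖y s‖⁻¹ • y s) (projectedField f (x t) (‖y t‖⁻¹ • y t)) J t := by
  -- The factor `‖y‖⁻¹` is written as `exp (-log ‖y‖)`, whose logarithmic derivative is already
  -- known.
  have h1 := (hasDerivWithinAt_log_norm hy ht (h0 t ht)).neg.exp.smul (hy t ht)
  have he : ∀ s ∈ J, Real.exp (-Real.log ‖y s‖) = ‖y s‖⁻¹ := fun s hs => by
    rw [Real.exp_neg, Real.exp_log (norm_pos_iff.2 (h0 s hs))]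
  refine (h1.congr (fun s hs => ?_) ?_).congr_deriv ?_
  · simp [he s hs]
  · simp [he t ht]
  · simp only [Pi.neg_apply, he t ht, projectedField, map_smul, smul_smul]
    rw [mul_neg, neg_smul, ← sub_eq_add_neg, mul_comm]

theorem auxiliaryExpr_eq {V : EuclideanSpace ℝ (Fin n) × EuclideanSpace ℝ (Fin n) → ℝ}
    (hV : Differentiable ℝ V) (a z : EuclideanSpace ℝ (Fin n)) :
    auxiliaryExpr f V a z = stretchRate f a z + fderiv ℝ V (a, z) (f a, projectedField f a z) := by
  have h1 : HasFDerivAt (fun a' => V (a', z))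
      ((fderiv ℝ V (a, z)).comp (ContinuousLinearMap.inl ℝ _ _)) a :=
    (hV (a, z)).hasFDerivAt.comp a (hasFDerivAt_prodMk_left a z)
  have h2 : HasFDerivAt (fun z' => V (a, z'))
      ((fderiv ℝ V (a, z)).comp (ContinuousLinearMap.inr ℝ _ _)) z :=
    (hV (a, z)).hasFDerivAt.comp z (hasFDerivAt_prodMk_right a z)
  rw [auxiliaryExpr, inner_gradient_right, inner_gradient_right, h1.fderiv, h2.fderiv, add_assoc]
  simp [← map_add]

/-- For any real `M` above the supremum for `V`, the function `q` below decreases once `x` stays in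
`B`; dividing by `t` removes the bounded term `V`. -/
theorem limsup_log_norm_le_auxiliaryBound (hf : ContDiff ℝ 1 f)
    {B : Set (EuclideanSpace ℝ (Fin n))} (hx : IsSolutionOn f x (Ici 0))
    (hb : Bornology.IsBounded (x '' Ici 0)) (hB : ∀ᶠ t in atTop, x t ∈ B)
    (hy : IsLinearizedSolutionOn f x y (Ici 0)) (h0 : y 0 ≠ 0) :
    limsup (fun t : ℝ => ((1 / t * Real.log ‖y t‖ : ℝ) : EReal)) atTop ≤ auxiliaryBound f B := by
  refine le_iInf₂ fun V hV => EReal.le_of_forall_lt_iff_le.1 fun M hM => ?_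
  have hne : ∀ t ∈ Ici (0 : ℝ), y t ≠ 0 := fun t ht => hy.ne_zero hf hx h0 ht
  set z : ℝ → EuclideanSpace ℝ (Fin n) := fun t => ‖y t‖⁻¹ • y t with hz
  have hzs : ∀ t ∈ Ici (0 : ℝ), z t ∈ sphere (0 : EuclideanSpace ℝ (Fin n)) 1 := fun t ht => by
    rw [mem_sphere_zero_iff_norm, hz, norm_smul, norm_inv, norm_norm,
      inv_mul_cancel₀ (norm_ne_zero_iff.2 (hne t ht))]
  have haux : ∀ a ∈ B, ∀ v ∈ sphere (0 : EuclideanSpace ℝ (Fin n)) 1, auxiliaryExpr f V a v ≤ M := by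
    intro a ha v hv
    have h1 : ((auxiliaryExpr f V a v : ℝ) : EReal) ≤ M := le_trans
      
      (le_iSup₂_of_le (f := fun b _ => ⨆ w ∈ sphere (0 : EuclideanSpace ℝ (Fin n)) 1,
        ((auxiliaryExpr f V b w : ℝ) : EReal)) a ha
        (le_iSup₂ (f := fun w _ => ((auxiliaryExpr f V a w : ℝ) : EReal)) v hv)) hM.le
    exact_mod_cast h1
  have hVd := hV.differentiable one_ne_zero
  obtain ⟨T₀, hT₀⟩ := eventually_atTop.1 hB
  set T : ℝ := max T₀ 0 with hTdef
  have hT : 0 ≤ T := le_max_right _ _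
  obtain ⟨R, hR⟩ := hb.subset_closedBall (0 : EuclideanSpace ℝ (Fin n))
  obtain ⟨C, hC⟩ := ((isCompact_closedBall (0 : EuclideanSpace ℝ (Fin n)) R).prod
    (isCompact_sphere 0 1)).exists_bound_of_continuousOn hV.continuous.continuousOn
  set q : ℝ → ℝ := fun t => Real.log ‖y t‖ + V (x t, z t) - M * t with hq
  have hqd : ∀ t ∈ Ici (0 : ℝ),
      HasDerivWithinAt q (auxiliaryExpr f V (x t) (z t) - M) (Ici 0) t := by
    intro t ht
    rw [auxiliaryExpr_eq hVd]
    refine HasDerivWithinAt.sub (HasDerivWithinAt.add (hasDerivWithinAt_log_norm hy ht (hne t ht))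
      ?_) (by simpa using (hasDerivWithinAt_id t (Ici 0)).const_mul M)
    exact (hVd (x t, z t)).hasFDerivAt.comp_hasDerivWithinAt t
      ((hx t ht).prodMk (hasDerivWithinAt_normalized hy ht hne))
  have hanti : AntitoneOn q (Ici T) := by
    have hsub : Ici T ⊆ Ici 0 := Ici_subset_Ici.2 hT
    refine antitoneOn_of_hasDerivWithinAt_nonpos (convex_Ici T)
      (f' := fun t => auxiliaryExpr f V (x t) (z t) - M)
      (fun t ht => ((hqd t (hsub ht)).mono hsub).continuousWithinAt) (fun t ht => ?_)
      fun t ht => ?_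
    · exact (hqd t (hsub (interior_subset ht))).mono (interior_subset.trans hsub)
    · have ht := interior_subset ht
      exact sub_nonpos.2 (haux _ (hT₀ t ((le_max_left _ _).trans ht)) _ (hzs t (hsub ht)))
  have hle : ∀ᶠ t : ℝ in atTop, 1 / t * Real.log ‖y t‖ ≤ M + (q T + C) / t := by
    filter_upwards [eventually_ge_atTop T, eventually_gt_atTop 0] with t ht ht0
    have h1 : q t ≤ q T := hanti self_mem_Ici ht ht
    have h2 : -C ≤ V (x t, z t) := (abs_le.1 (hC (x t, z t)
      ⟨hR (mem_image_of_mem _ ht0.le), hzs t ht0.le⟩)).1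
    have h3 : Real.log ‖y t‖ ≤ M * t + (q T + C) := by
      have : q t = Real.log ‖y t‖ + V (x t, z t) - M * t := rfl
      linarith
    rw [one_div, inv_mul_le_iff₀ ht0, mul_add, mul_div_cancel₀ _ ht0.ne']
    linarith
  have hlim : Tendsto (fun t : ℝ => ((M + (q T + C) / t : ℝ) : EReal)) atTop (nhds (M : EReal)) := by
    rw [EReal.tendsto_coe]
    simpa using (tendsto_const_nhds (x := q T + C)).div_atTop tendsto_id |>.const_add M
  rw [← hlim.limsup_eq]
  exact limsup_le_limsup (hle.mono fun t ht => EReal.coe_le_coe_iff.2 ht)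

end Trajectories

/-! ### The reverse bound on compact invariant sets -/

section CompactInvariant

variable {n : ℕ} {f : EuclideanSpace ℝ (Fin n) → EuclideanSpace ℝ (Fin n)}
  {B : Set (EuclideanSpace ℝ (Fin n))}

theorem contDiff_stretchRate (hf : ContDiff ℝ 2 f) :
    ContDiff ℝ 1 fun w : EuclideanSpace ℝ (Fin n) × EuclideanSpace ℝ (Fin n) =>
      stretchRate f w.1 w.2 :=
  contDiff_snd.inner ℝ (((hf.fderiv_right (m := 1) (by norm_num)).comp contDiff_fst).clm_apply
    contDiff_snd)

theorem contDiff_projectedField (hf : ContDiff ℝ 2 f) :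
    ContDiff ℝ 1 fun w : EuclideanSpace ℝ (Fin n) × EuclideanSpace ℝ (Fin n) =>
      projectedField f w.1 w.2 :=
  (((hf.fderiv_right (m := 1) (by norm_num)).comp contDiff_fst).clm_apply contDiff_snd).sub
    ((contDiff_stretchRate hf).smul contDiff_snd)

/-- The field `(f, ℓ)` and the function `Φ` agree, near a compact forward invariant `B` times the
unit sphere, with a globally Lipschitz field and a Lipschitz function; the flow of that field
preserves `B × S^{n-1}`. -/
theorem exists_isGlobalFlow_extension (hf : ContDiff ℝ 2 f) (hB : IsCompact B)
    (hinv : IsForwardInvariantSet f B) :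
    ∃ (G : EuclideanSpace ℝ (Fin n) × EuclideanSpace ℝ (Fin n) →
        EuclideanSpace ℝ (Fin n) × EuclideanSpace ℝ (Fin n))
      (φ : EuclideanSpace ℝ (Fin n) × EuclideanSpace ℝ (Fin n) → ℝ)
      (γ : EuclideanSpace ℝ (Fin n) × EuclideanSpace ℝ (Fin n) → ℝ →
        EuclideanSpace ℝ (Fin n) × EuclideanSpace ℝ (Fin n)),
      IsGlobalFlow G γ ∧ (∃ K, LipschitzWith K G) ∧ (∃ L, LipschitzWith L φ) ∧
      (∀ w ∈ B ×ˢ sphere (0 : EuclideanSpace ℝ (Fin n)) 1,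
        G w = (f w.1, projectedField f w.1 w.2) ∧ φ w = stretchRate f w.1 w.2) ∧
      ∀ w ∈ B ×ˢ sphere (0 : EuclideanSpace ℝ (Fin n)) 1, ∀ t, 0 ≤ t →
        γ w t ∈ B ×ˢ sphere (0 : EuclideanSpace ℝ (Fin n)) 1 := by
  obtain ⟨R, hR1, hR⟩ : ∃ R : ℝ, 1 ≤ R ∧ ∀ a ∈ B, ‖a‖ ≤ R := by
    obtain ⟨R, hR⟩ := hB.isBounded.exists_norm_le
    exact ⟨max 1 R, le_max_left _ _, fun a ha => (hR a ha).trans (le_max_right _ _)⟩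
  -- As `R ≥ 1`, `B × S^{n-1}` lies in the ball of radius `R`; the extra `1` leaves a margin where
  -- the cutoff is still `1`.
  let b : ContDiffBump (0 : EuclideanSpace ℝ (Fin n) × EuclideanSpace ℝ (Fin n)) :=
    ⟨R + 1, R + 2, by linarith, by linarith⟩
  have hb1 : ∀ w, ‖w‖ ≤ R + 1 → b w = 1 := fun w hw =>
    b.one_of_mem_closedBall (by simpa [b] using hw)
  set G : EuclideanSpace ℝ (Fin n) × EuclideanSpace ℝ (Fin n) →
    EuclideanSpace ℝ (Fin n) × EuclideanSpace ℝ (Fin n) :=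
    fun w => b w • (f w.1, projectedField f w.1 w.2) with hG
  set φ : EuclideanSpace ℝ (Fin n) × EuclideanSpace ℝ (Fin n) → ℝ :=
    fun w => b w • stretchRate f w.1 w.2 with hφ
  have hGs : ContDiff ℝ 1 G := b.contDiff.smul
    (((hf.of_le (by norm_num)).comp contDiff_fst).prodMk (contDiff_projectedField hf))
  have hφs : ContDiff ℝ 1 φ := b.contDiff.smul (contDiff_stretchRate hf)
  have hGc : HasCompactSupport G := b.hasCompactSupport.smul_right
  have hφc : HasCompactSupport φ := b.hasCompactSupport.smul_right
  obtain ⟨K, hK⟩ := hGs.lipschitzWith_of_hasCompactSupport hGc one_ne_zero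
  obtain ⟨L, hL⟩ := hφs.lipschitzWith_of_hasCompactSupport hφc one_ne_zero
  obtain ⟨C, hC⟩ := hGc.exists_bound_of_continuous hGs.continuous
  obtain ⟨γ, hγ⟩ := exists_isGlobalFlow (C := C.toNNReal) hK
    fun w => (hC w).trans (Real.le_coe_toNNReal C)
  have hnorm : ∀ w ∈ B ×ˢ sphere (0 : EuclideanSpace ℝ (Fin n)) 1, ‖w‖ ≤ R := fun w hw =>
    norm_prod_le_iff.2 ⟨hR _ hw.1, (mem_sphere_zero_iff_norm.1 hw.2).le.trans hR1⟩
  have hsphere : ∀ w ∈ B ×ˢ sphere (0 : EuclideanSpace ℝ (Fin n)) 1, ∀ t, 0 ≤ t →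
      ‖(γ w t).2‖ = 1 := by
    intro w hw t ht
    have hzd : ∀ s, HasDerivAt (fun s => (γ w s).2) (G (γ w s)).2 s := fun s =>
      (hγ.hasDerivAt w s).snd
    -- The same cutoff multiplies `G` and `φ`, so this linear equation for `|z|² - 1` holds
    -- everywhere, also off `B`.
    have hud : ∀ s, HasDerivAt (fun s => ‖(γ w s).2‖ ^ 2 - 1)
        (-2 * φ (γ w s) * (‖(γ w s).2‖ ^ 2 - 1)) s := fun s => by
      refine ((hzd s).norm_sq.sub_const 1).congr_deriv ?_
      simp only [hG, hφ, Prod.smul_snd, projectedField, inner_smul_right, inner_sub_right,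
        real_inner_self_eq_norm_sq, smul_eq_mul]
      simp only [stretchRate]
      ring
    obtain ⟨D, hD⟩ := isCompact_Icc.exists_bound_of_continuousOn (s := Icc 0 t)
      (hL.continuous.comp (hγ.continuous w)).continuousOn
    have := eq_zero_of_abs_deriv_le_mul_abs_self_of_eq_zero_right (a := 0) (b := t) (K := 2 * D)
      (fun s _ => (hud s).continuousAt.continuousWithinAt)
      (fun s _ => (hud s).hasDerivWithinAt)
      (by rw [hγ.map_zero, mem_sphere_zero_iff_norm.1 hw.2]; norm_num) (fun s hs => by
        rw [norm_mul, norm_mul, norm_neg, Real.norm_two]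
        gcongr
        exact hD s (Ico_subset_Icc_self hs)) t ⟨ht, le_rfl⟩
    have h1 : ‖(γ w t).2‖ ^ 2 = 1 := by linarith
    exact (pow_eq_one_iff_of_nonneg (norm_nonneg _) two_ne_zero).1 h1
  refine ⟨G, φ, γ, hγ, ⟨K, hK⟩, ⟨L, hL⟩, fun w hw => ?_, fun w hw T hT => ?_⟩
  · have := hb1 w ((hnorm w hw).trans (by linarith))
    simp [hG, hφ, this]
  · refine ⟨?_, mem_sphere_zero_iff_norm.2 (hsphere w hw T hT)⟩
    have hxc : Continuous fun t => (γ w t).1 := continuous_fst.comp (hγ.continuous w)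
    -- Continuous induction: from a time in `B` the curve stays briefly where the cutoff is `1`,
    -- hence solves the original equation, and invariance of `B` applies.
    have hsub : Icc 0 T ⊆ {t | (γ w t).1 ∈ B} := by
      refine IsClosed.Icc_subset_of_forall_exists_gt
        ((hB.isClosed.preimage hxc).inter isClosed_Icc) ?_ ?_
      · simpa [hγ.map_zero] using hw.1
      · rintro s ⟨hsB, hs0, -⟩ r hr
        have hsn : ‖γ w s‖ < R + 1 := lt_of_le_of_lt (hnorm _ ⟨hsB, mem_sphere_zero_iff_norm.2
          (hsphere w hw s hs0)⟩) (by linarith)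
        obtain ⟨δ, hδ, hδn⟩ := Metric.eventually_nhds_iff.1
          ((hγ.continuous w).norm.continuousAt.eventually_lt continuousAt_const hsn)
        set τ : ℝ := min (δ / 2) (r - s) with hτ
        have hτ0 : 0 < τ := lt_min (by linarith) (sub_pos.2 hr)
        refine ⟨s + τ, ?_, by linarith, by linarith [min_le_right (δ / 2) (r - s)]⟩
        refine hinv τ (fun t => (γ w (s + t)).1) (fun t ht => ?_) (by simpa using hsB) τ
          ⟨hτ0.le, le_rfl⟩
        have h1 : HasDerivAt (fun t => (γ w (s + t)).1) (G (γ w (s + t))).1 t :=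
          ((hγ.hasDerivAt w (s + t)).comp_const_add s t).fst
        have h2 : b (γ w (s + t)) = 1 := hb1 _ (hδn (by
          rw [Real.dist_eq, add_sub_cancel_left, abs_of_nonneg ht.1]
          linarith [ht.2, min_le_left (δ / 2) (r - s)])).le
        have h3 : (G (γ w (s + t))).1 = f (γ w (s + t)).1 := by simp [hG, h2]
        rw [h3] at h1
        exact h1.hasDerivWithinAt
    exact hsub ⟨hT, le_rfl⟩

theorem auxiliaryBound_le_maximalLyapunovExponent (hf : ContDiff ℝ 2 f) (hB : IsCompact B)
    (hinv : IsForwardInvariantSet f B) :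
    auxiliaryBound f B ≤ maximalLyapunovExponent f B := by
  obtain ⟨G, φ, γ, hγ, ⟨K, hK⟩, ⟨L, hL⟩, hext, hstay⟩ := exists_isGlobalFlow_extension hf hB hinv
  refine EReal.ge_of_forall_gt_iff_ge.1 fun a' ha' => ?_
  -- The gap `c - a` absorbs the mollification error; the gap `a - a'` pays for passing to a single
  -- initial condition.
  obtain ⟨a, haa, ha⟩ := EReal.lt_iff_exists_real_btwn.1 ha'
  obtain ⟨c, hac, hc⟩ := EReal.lt_iff_exists_real_btwn.1 ha
  rw [EReal.coe_lt_coe_iff] at haa hac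
  have hlarge : ∀ T, 0 < T → ∃ w ∈ B ×ˢ sphere (0 : EuclideanSpace ℝ (Fin n)) 1,
      a * T ≤ ∫ t in (0 : ℝ)..T, φ (γ w t) := by
    intro T hT
    by_contra! hcon
    obtain ⟨V, hV, hVφ⟩ := hγ.exists_contDiff_approx_average hK hL hT (sub_pos.2 hac)
    refine absurd hc (not_lt.2 (iInf₂_le_of_le V hV ?_))
    refine iSup₂_le fun u hu => iSup₂_le fun z hz => EReal.coe_le_coe_iff.2 ?_
    have hw : (u, z) ∈ B ×ˢ sphere (0 : EuclideanSpace ℝ (Fin n)) 1 := ⟨hu, hz⟩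
    have h1 := (abs_le.1 (hVφ (u, z))).2
    have h2 := (div_lt_iff₀ hT).2 (hcon _ hw)
    rw [(hext _ hw).1, (hext _ hw).2] at h1
    rw [auxiliaryExpr_eq (hV.differentiable one_ne_zero)]
    linarith
  obtain ⟨p, hp, hpτ⟩ := hγ.exists_forall_mul_le_integral hK hL (hB.prod (isCompact_sphere 0 1))
    hstay haa hlarge
  have hcont : Continuous fun t => φ (γ p t) := hL.continuous.comp (hγ.continuous p)
  set I : ℝ → ℝ := fun s => ∫ t in (0 : ℝ)..s, φ (γ p t) with hI
  have hId : ∀ t, HasDerivAt I (φ (γ p t)) t := fun t =>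
    intervalIntegral.integral_hasDerivAt_right (hcont.intervalIntegrable _ _)
      (hcont.stronglyMeasurableAtFilter _ _) hcont.continuousAt
  have hlog : ∀ t, 0 ≤ t → Real.log ‖Real.exp (I t) • (γ p t).2‖ = I t := fun t ht => by
    rw [norm_smul, mem_sphere_zero_iff_norm.1 (hstay p hp t ht).2, mul_one, Real.norm_eq_abs,
      Real.abs_exp, Real.log_exp]
  -- The linearized solution is rebuilt as `exp(I) z`: the growth `I' = Φ` cancels the term `-Φ z`
  -- of `ℓ`.
  refine le_trans ?_ (le_sSup ⟨p.1, hp.1, p.2, hp.2, fun t => (γ p t).1,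
    fun t => Real.exp (I t) • (γ p t).2, fun t ht => ?_, by simp [hγ.map_zero], fun t ht => ?_,
    by simp [hI, hγ.map_zero], rfl⟩)
  · refine le_limsup_of_frequently_le (Eventually.frequently ?_)
    filter_upwards [eventually_gt_atTop (0 : ℝ)] with t ht
    rw [hlog t ht.le, EReal.coe_le_coe_iff, one_div, le_inv_mul_iff₀ ht, mul_comm]
    exact hpτ t ht.le
  · have h1 : HasDerivAt (fun t => (γ p t).1) (G (γ p t)).1 t := (hγ.hasDerivAt p t).fst
    rw [(hext _ (hstay p hp t ht)).1] at h1
    exact h1.hasDerivWithinAt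
  · have h1 : HasDerivAt (fun t => (γ p t).2) (G (γ p t)).2 t := (hγ.hasDerivAt p t).snd
    have h2 := hId t
    rw [(hext _ (hstay p hp t ht)).1] at h1
    rw [(hext _ (hstay p hp t ht)).2] at h2
    refine (h2.exp.smul h1).hasDerivWithinAt.congr_deriv ?_
    simp only [projectedField, map_smul, smul_sub, smul_smul, sub_add_cancel]

end CompactInvariant

/-! ### Both statements -/

theorem mainTheorem1 (n : ℕ) (f : EuclideanSpace ℝ (Fin n) → EuclideanSpace ℝ (Fin n)) :
    (ContDiff ℝ 1 f →
      ∀ B₀ B : Set (EuclideanSpace ℝ (Fin n)),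
        (∀ x₀ ∈ B₀, ∃ x : ℝ → EuclideanSpace ℝ (Fin n),
          IsSolutionOn f x (Ici 0) ∧ x 0 = x₀ ∧ Bornology.IsBounded (x '' Ici 0) ∧
            ∀ᶠ t in atTop, x t ∈ B) →
        maximalLyapunovExponent f B₀ ≤ auxiliaryBound f B) ∧
    (ContDiff ℝ 2 f →
      ∀ B : Set (EuclideanSpace ℝ (Fin n)),
        IsCompact B → IsForwardInvariantSet f B →
        maximalLyapunovExponent f B = auxiliaryBound f B) := by
  refine ⟨fun hf B₀ B hB₀ => ?_, fun hf B hB hinv => le_antisymm ?_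
    (auxiliaryBound_le_maximalLyapunovExponent hf hB hinv)⟩
  · refine sSup_le ?_
    rintro m ⟨x₀, hx₀, y₀, hy₀, x, y, hx, rfl, hy, rfl, rfl⟩
    obtain ⟨x', hx', h0, hb, hmem⟩ := hB₀ _ hx₀
    -- Uniqueness transfers boundedness and entry into `B` to the trajectory that defines the
    -- exponent.
    have heq : EqOn x x' (Ici 0) := hx.eqOn hf hx' h0.symm
    refine limsup_log_norm_le_auxiliaryBound hf hx (by rwa [heq.image_eq]) ?_ hy
      (ne_zero_of_mem_unit_sphere ⟨_, hy₀⟩)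
    filter_upwards [hmem, eventually_ge_atTop 0] with t ht ht0
    rwa [heq ht0]
  · refine sSup_le ?_
    rintro m ⟨x₀, hx₀, y₀, hy₀, x, y, hx, rfl, hy, rfl, rfl⟩
    have hstay : ∀ t ∈ Ici (0 : ℝ), x t ∈ B := fun t ht =>
      hinv t x (hx.mono Icc_subset_Ici_self) hx₀ t ⟨ht, le_rfl⟩
    exact limsup_log_norm_le_auxiliaryBound (hf.of_le (by norm_num)) hx
      (hB.isBounded.subset (image_subset_iff.2 hstay))
      ((eventually_ge_atTop 0).mono hstay) hy (ne_zero_of_mem_unit_sphere ⟨_, hy₀⟩)
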